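/- For $F\colon\mathbb{C}\to\mathbb{C}$ and $w\in\mathbb{C}$ write $F_w(z)=F(z+w)\,e^{-i\,\mathrm{Im}(z\bar w)}$ (twisted shift), let $DF(z)\in\mathbb{R}^{2\times 2}$ denote the real differential of $F$, and put $\mathcal D_1F=\partial F-\tfrac{\bar z}{2}F$, $\mathcal D_2F=\bar\partial F+\tfrac{z}{2}F$. Let $|x+iy|_\infty=\max\{|x|,|y|\}$. Let $H\colon\mathbb{C}\to\mathbb{C}$ be $C^6$ in the real sense, with $H(0)=1$ and $|H(z)|<1$ for all $z\neq 0$. Then there is a constant $C>0$, depending only on $H$, with the following property. Let $F=F^1+\sigma F^0$, where $\sigma>0$; $F^1\colon\mathbb{C}\to\mathbb{C}$ is deterministic, twice continuously differentiable in the real sense, with $F^1$, $\mathcal D_iF^1$, $\mathcal D_i\mathcal D_jF^1$ ($i,j\in\{1,2\}$) bounded; and $F^0$ is a zero-mean circularly symmetric complex Gaussian random field on $\mathbb{C}$ with covariance $$\mathbb{E}\big[F^0(z)\overline{F^0(w)}\big]=H(z-w)\,e^{i\,\mathrm{Im}(z\bar w)},\qquad z,w\in\mathbb{C},$$ whose realizations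 are almost surely $C^2$ in the real sense. Let $\alpha,\beta>0$. Then: (i) For each $\lambda\in\mathbb{C}$, $$\mathbb{P}\big(|F_\lambda(0)|\le\alpha \text{ and } |\det DF_\lambda(0)|\le\beta\big)\le C\,\alpha^2\beta\,\sigma^{-4}.$$ (ii) Let $0<\delta\le 1$, $L\ge 1$, $\delta^*=2\lceil\delta^{-1/2}/4\rceil\,\delta$, $\delta^{**}=\lceil\delta^{-1/2}\rceil\,\delta$, and let $X_L$ be the sparse grid $$X_L=\big\{\mu\in\delta(\mathbb{Z}+i\mathbb{Z}) : |\mu|_\infty\le L,\ |\mu-\lambda|_\infty=\delta^{**}\text{ for some }\lambda\in\delta^*(\mathbb{Z}+i\mathbb{Z})\big\}.$$ Then $$\mathbb{P}\big(\exists\,\lambda\in X_L:\ |F_\lambda(0)|\le\alpha \text{ and } |\det DF_\lambda(0)|\le\beta\big)\le C\,L^2\alpha^2\beta\,\sigma^{-4}\delta^{-3/2}.$$ -/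

import Mathlib

namespace GWHF

noncomputable section

open MeasureTheory ProbabilityTheory

/-! ### Deterministic notions on functions of the complex plane -/

/-- The twisted shift `F_w(z) = F(z + w) e^{-i Im(z \bar w)}`. -/
def twistedShift (F : ℂ → ℂ) (w : ℂ) : ℂ → ℂ := fun z =>
  F (z + w) * Complex.exp (-Complex.I * ((z * (starRingEnd ℂ) w).im : ℂ))

/-- The Jacobian determinant `det DF(z)` of `F`, seen as a map of the real plane to itself. -/
def jacobianDet (F : ℂ → ℂ) (z : ℂ) : ℝ := (fderiv ℝ F z).det

/-- The Wirtinger derivative `∂F = (∂_x F - i ∂_y F) / 2`. -/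
def dz (F : ℂ → ℂ) (z : ℂ) : ℂ :=
  (fderiv ℝ F z 1 - Complex.I * fderiv ℝ F z Complex.I) / 2

/-- The Wirtinger derivative `\bar∂F = (∂_x F + i ∂_y F) / 2`. -/
def dzbar (F : ℂ → ℂ) (z : ℂ) : ℂ :=
  (fderiv ℝ F z 1 + Complex.I * fderiv ℝ F z Complex.I) / 2

/-- The twisted derivative `∂F(z) - (\bar z / 2) F(z)`. -/
def twistedD1 (F : ℂ → ℂ) : ℂ → ℂ := fun z => dz F z - (starRingEnd ℂ) z / 2 * F z

/-- The twisted derivative `\bar∂F(z) + (z / 2) F(z)`. -/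
def twistedD2 (F : ℂ → ℂ) : ℂ → ℂ := fun z => dzbar F z + z / 2 * F z

/-- The two twisted derivatives, as a family. -/
def twistedD : Fin 2 → (ℂ → ℂ) → ℂ → ℂ := ![twistedD1, twistedD2]

/-! ### The input model -/

/-- The assumptions on the deterministic part `F¹`: it is `C²` in the real sense, and it is bounded
together with its twisted derivatives of order one and two. -/
structure IsAdmissibleMean (F₁ : ℂ → ℂ) : Prop where
  contDiff : ContDiff ℝ 2 F₁
  bounded : ∃ A : ℝ, ∀ z : ℂ, ‖F₁ z‖ ≤ A ∧ (∀ i, ‖twistedD i F₁ z‖ ≤ A) ∧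
    ∀ i j, ‖twistedD i (twistedD j F₁) z‖ ≤ A

/-- The assumptions on the twisted kernel `H`. -/
structure IsAdmissibleKernel (H : ℂ → ℂ) : Prop where
  contDiff : ContDiff ℝ 6 H
  map_zero : H 0 = 1
  norm_lt_one : ∀ z : ℂ, z ≠ 0 → ‖H z‖ < 1

/-- `F₀` is a circularly symmetric complex Gaussian random field on the plane with mean zero,
covariance `E[F₀(z) \overline{F₀(w)}] = H(z - w) e^{i Im(z \bar w)}`, and almost surely
`C²` realizations (in the real sense). -/
structure IsTwistedGaussianField {Ω : Type*} [MeasurableSpace Ω] (μ : Measure Ω)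
    (H : ℂ → ℂ) (F₀ : ℂ → Ω → ℂ) : Prop where
  /-- the finite-dimensional marginals are Gaussian (as real vectors) -/
  isGaussianProcess : IsGaussianProcess F₀ μ
  /-- the finite-dimensional marginals are invariant under multiplication by unit scalars -/
  circular : ∀ (I : Finset ℂ) (θ : ℝ),
    μ.map (fun ω (z : I) => Complex.exp (Complex.I * θ) * F₀ z ω) =
      μ.map (fun ω (z : I) => F₀ z ω)
  mean_zero : ∀ z : ℂ, ∫ ω, F₀ z ω ∂μ = 0
  covariance : ∀ z w : ℂ, ∫ ω, F₀ z ω * (starRingEnd ℂ) (F₀ w ω) ∂μ =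
    H (z - w) * Complex.exp (Complex.I * ((z * (starRingEnd ℂ) w).im : ℂ))
  contDiff : ∀ᵐ ω ∂μ, ContDiff ℝ 2 (fun z => F₀ z ω)

/-- The realization `z ↦ F¹(z) + σ F⁰(z)` of the random input at the outcome `ω`. -/
def input {Ω : Type*} (F₁ : ℂ → ℂ) (σ : ℝ) (F₀ : ℂ → Ω → ℂ) (ω : Ω) : ℂ → ℂ :=
  fun z => F₁ z + (σ : ℂ) * F₀ z ω

/-- The estimates `|F_lam(0)| ≤ α` and `|det DF_lam(0)| ≤ β`. -/
def AlmostDegenerate (F : ℂ → ℂ) (α β : ℝ) (lam : ℂ) : Prop :=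
  ‖twistedShift F lam 0‖ ≤ α ∧ |jacobianDet (twistedShift F lam) 0| ≤ β

/-! ### The grids -/

/-- The norm `|x + iy|_∞ = max(|x|, |y|)`. -/
def supNorm (z : ℂ) : ℝ := max |z.re| |z.im|

/-- The square grid `{s k + i s j : k, j ∈ ℤ}` with spacing `s`. -/
def grid (s : ℝ) : Set ℂ :=
  {z | ∃ k j : ℤ, z = ((s * k : ℝ) : ℂ) + Complex.I * ((s * j : ℝ) : ℂ)}

/-- The spacing `δ^* = 2 ⌈δ^{-1/2} / 4⌉ δ` of the coarse grid. -/
def deltaStar (δ : ℝ) : ℝ := 2 * (⌈δ ^ (-1 / 2 : ℝ) / 4⌉ : ℝ) * δ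

/-- The coarse scale `δ^{**} = ⌈δ^{-1/2}⌉ δ`. -/
def deltaStarStar (δ : ℝ) : ℝ := (⌈δ ^ (-1 / 2 : ℝ)⌉ : ℝ) * δ

/-- The sparse grid `X_L`: the points of the fine grid in `[-L, L]²` which lie at `∞`-distance
exactly `δ^{**}` from some point of the coarse grid. -/
def sparseGrid (δ L : ℝ) : Set ℂ :=
  {x | x ∈ grid δ ∧ supNorm x ≤ L ∧
    ∃ lam ∈ grid (deltaStar δ), supNorm (x - lam) = deltaStarStar δ}

end

end GWHF

namespace GWHF

open MeasureTheory ProbabilityTheory Filter Topology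
open scoped ENNReal NNReal ComplexConjugate

/-- A finite family of complex random variables which is centred, jointly Gaussian and circularly
symmetric, with covariance matrix `K`. -/
structure IsCircularGaussian {Ω : Type*} [MeasurableSpace Ω] {ι : Type*} [Fintype ι]
    (μ : Measure Ω) (g : ι → Ω → ℂ) (K : ι → ι → ℂ) : Prop where
  hasGaussianLaw : HasGaussianLaw (fun ω i => g i ω) μ
  mean_zero : ∀ i, ∫ ω, g i ω ∂μ = 0
  pseudo_covariance : ∀ i j, ∫ ω, g i ω * g j ω ∂μ = 0
  covariance : ∀ i j, ∫ ω, g i ω * conj (g j ω) ∂μ = K i j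

namespace IsCircularGaussian

variable {Ω : Type*} [MeasurableSpace Ω] {ι κ : Type*} [Fintype ι] [Fintype κ]
  {μ : Measure Ω} {g : ι → Ω → ℂ} {K : ι → ι → ℂ}

theorem memLp_two (h : IsCircularGaussian μ g K) (i : ι) : MemLp (g i) 2 μ :=
  (h.hasGaussianLaw.eval i).memLp_two

theorem integrable_mul (h : IsCircularGaussian μ g K) (i j : ι) :
    Integrable (fun ω => g i ω * g j ω) μ :=
  (h.memLp_two i).integrable_mul (h.memLp_two j)

theorem memLp_conj (h : IsCircularGaussian μ g K) (i : ι) :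
    MemLp (fun ω => conj (g i ω)) 2 μ :=
  (h.memLp_two i).star

theorem integrable_mul_conj (h : IsCircularGaussian μ g K) (i j : ι) :
    Integrable (fun ω => g i ω * conj (g j ω)) μ :=
  (h.memLp_two i).integrable_mul (h.memLp_conj j)

theorem conj_covariance (h : IsCircularGaussian μ g K) (i j : ι) : conj (K i j) = K j i := by
  rw [← h.covariance, ← h.covariance, ← integral_conj]
  simp [mul_comm]

/-- Linear images of circularly symmetric Gaussian vectors are of the same kind. -/
theorem map (h : IsCircularGaussian μ g K) (A : κ → ι → ℂ) :
    IsCircularGaussian μ (fun k ω => ∑ i, A k i * g i ω)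
      (fun k l => ∑ j, ∑ i, A k i * conj (A l j) * K i j) where
  hasGaussianLaw := by
    let T : (ι → ℂ) →L[ℝ] (κ → ℂ) :=
      ContinuousLinearMap.restrictScalars ℝ (Matrix.mulVecLin (Matrix.of A)).toContinuousLinearMap
    exact h.hasGaussianLaw.map T
  mean_zero k := by
    rw [integral_finsetSum]
    · simp [integral_const_mul, h.mean_zero]
    · exact fun i _ => (h.hasGaussianLaw.eval i).integrable.const_mul _
  pseudo_covariance k l := by
    have : ∀ ω, (∑ i, A k i * g i ω) * (∑ j, A l j * g j ω) =
        ∑ i, ∑ j, (A k i * A l j) * (g i ω * g j ω) := fun ω => by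
      rw [Finset.sum_mul_sum]
      exact Finset.sum_congr rfl fun i _ => Finset.sum_congr rfl fun j _ => by ring
    simp_rw [this]
    rw [integral_finsetSum]
    · refine Finset.sum_eq_zero fun i _ => ?_
      rw [integral_finsetSum]
      · simp [integral_const_mul, h.pseudo_covariance]
      · exact fun j _ => (h.integrable_mul i j).const_mul _
    · exact fun i _ => integrable_finsetSum _ fun j _ => (h.integrable_mul i j).const_mul _
  covariance k l := by
    have : ∀ ω, (∑ i, A k i * g i ω) * conj (∑ j, A l j * g j ω) =
        ∑ j, ∑ i, (A k i * conj (A l j)) * (g i ω * conj (g j ω)) := fun ω => by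
      rw [map_sum, Finset.sum_mul_sum, Finset.sum_comm]
      exact Finset.sum_congr rfl fun i _ => Finset.sum_congr rfl fun j _ => by
        rw [map_mul]; ring
    simp_rw [this]
    rw [integral_finsetSum]
    · refine Finset.sum_congr rfl fun j _ => ?_
      rw [integral_finsetSum]
      · exact Finset.sum_congr rfl fun i _ => by rw [integral_const_mul, h.covariance]
      · exact fun i _ => (h.integrable_mul_conj i j).const_mul _
    · exact fun j _ => integrable_finsetSum _ fun i _ => (h.integrable_mul_conj i j).const_mul _

theorem integral_re_mul_re (h : IsCircularGaussian μ g K) (i j : ι) :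
    ∫ ω, (g i ω).re * (g j ω).re ∂μ = (K i j).re / 2 := by
  have e : ∀ ω, (g i ω).re * (g j ω).re =
      RCLike.re ((g i ω * g j ω + g i ω * conj (g j ω)) / 2) := fun ω => by
    simp
  simp_rw [e]
  have hint : Integrable (fun ω => (g i ω * g j ω + g i ω * conj (g j ω)) / 2) μ :=
    ((h.integrable_mul i j).add (h.integrable_mul_conj i j)).div_const 2
  rw [_root_.integral_re hint, integral_div,
    integral_add (h.integrable_mul i j) (h.integrable_mul_conj i j),
    h.pseudo_covariance, h.covariance]
  simp

theorem integral_re (h : IsCircularGaussian μ g K) (i : ι) :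
    ∫ ω, (g i ω).re ∂μ = 0 := by
  have := _root_.integral_re (h.hasGaussianLaw.eval i).integrable
  rw [h.mean_zero] at this
  simpa using this

theorem memLp_re (h : IsCircularGaussian μ g K) (i : ι) :
    MemLp (fun ω => (g i ω).re) 2 μ :=
  (h.memLp_two i).re

theorem covariance_re_re (h : IsCircularGaussian μ g K) (i j : ι) :
    cov[fun ω => (g i ω).re, fun ω => (g j ω).re; μ] = (K i j).re / 2 := by
  have := h.hasGaussianLaw.isProbabilityMeasure
  rw [covariance_eq_sub (h.memLp_re i) (h.memLp_re j), h.integral_re i, zero_mul, sub_zero,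
    ← h.integral_re_mul_re]
  rfl

end IsCircularGaussian

theorem gaussianReal_le_smul_volume (m : ℝ) {v : ℝ≥0} (hv : v ≠ 0) :
    gaussianReal m v ≤ ENNReal.ofReal (1 / √(2 * Real.pi * v)) • (volume : Measure ℝ) := by
  rw [gaussianReal_of_var_ne_zero m hv, ← withDensity_const]
  refine withDensity_mono (Filter.Eventually.of_forall fun x => ?_)
  rw [gaussianPDF]
  refine ENNReal.ofReal_le_ofReal ?_
  rw [gaussianPDFReal, one_div]
  refine mul_le_of_le_one_right (by positivity) (Real.exp_le_one_iff.2 ?_)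
  rw [neg_div]
  exact neg_nonpos.2 (by positivity)

/-- Every real linear functional on the complex plane is the real part of a complex one. -/
theorem strongDual_complex_eq_re (T : StrongDual ℝ ℂ) :
    ∃ a : ℂ, ∀ z, T z = (a * z).re := by
  refine ⟨⟨T 1, -T Complex.I⟩, fun z => ?_⟩
  have : z = z.re • (1 : ℂ) + z.im • Complex.I := by
    apply Complex.ext <;> simp
  conv_lhs => rw [this]
  simp only [map_add, map_smul, smul_eq_mul, Complex.mul_re]
  ring

namespace IsCircularGaussian

variable {Ω : Type*} [MeasurableSpace Ω] {ι : Type*} [Fintype ι]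
  {μ : Measure Ω} {g : ι → Ω → ℂ} {K : ι → ι → ℂ}

theorem indepFun_prodMk (h : IsCircularGaussian μ g K) {i j k : ι} (hij : K i j = 0)
    (hkj : K k j = 0) :
    IndepFun (fun ω => (g i ω, g k ω)) (g j) μ := by
  classical
  refine HasGaussianLaw.indepFun_of_covariance_strongDual ?_ fun S T => ?_
  · let P : (ι → ℂ) →L[ℝ] ((ℂ × ℂ) × ℂ) :=
      ((ContinuousLinearMap.proj i).prod (ContinuousLinearMap.proj k)).prod
        (ContinuousLinearMap.proj j)
    exact h.hasGaussianLaw.map P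
  · obtain ⟨a, ha⟩ := strongDual_complex_eq_re (S ∘L ContinuousLinearMap.inl ℝ ℂ ℂ)
    obtain ⟨c, hc⟩ := strongDual_complex_eq_re (S ∘L ContinuousLinearMap.inr ℝ ℂ ℂ)
    obtain ⟨b, hb⟩ := strongDual_complex_eq_re T
    have hS : ∀ z w, S (z, w) = (a * z + c * w).re := fun z w => by
      rw [Complex.add_re, ← ha, ← hc, ContinuousLinearMap.comp_apply,
        ContinuousLinearMap.comp_apply, ← map_add]
      simp
    let A : Fin 2 → ι → ℂ :=
      ![fun l => (if l = i then a else 0) + (if l = k then c else 0),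
        fun l => if l = j then b else 0]
    have hA := (h.map A).covariance_re_re 0 1
    have e0 : (fun ω => (∑ l, A 0 l * g l ω).re) = S ∘ fun ω => (g i ω, g k ω) := by
      funext ω
      simp [A, hS, add_mul, Finset.sum_add_distrib]
    have e1 : (fun ω => (∑ l, A 1 l * g l ω).re) = T ∘ g j := by
      funext ω
      simp [A, hb]
    rw [e0, e1] at hA
    have hz : ∑ n, ∑ m, A 0 m * conj (A 1 n) * K m n = 0 := by
      simp [A, add_mul, Finset.sum_add_distrib, apply_ite conj, hij, hkj]
    rw [hA, hz, Complex.zero_re, zero_div]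

theorem rotation (h : IsCircularGaussian μ g K) (i : ι) :
    IsCircularGaussian μ (fun k ω => ![1, -Complex.I] k * g i ω)
      ![![K i i, Complex.I * K i i], ![-Complex.I * K i i, K i i]] := by
  classical
  have hmap := h.map (fun (k : Fin 2) l => if l = i then ![1, -Complex.I] k else 0)
  have e1 : (fun (k : Fin 2) ω => ![1, -Complex.I] k * g i ω) = fun k ω =>
      ∑ l, (if l = i then ![1, -Complex.I] k else 0) * g l ω := by
    funext k ω
    simp
  have e2 : (![![K i i, Complex.I * K i i], ![-Complex.I * K i i, K i i]] : Fin 2 → Fin 2 → ℂ) =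
      fun k l => ∑ n, ∑ m, (if m = i then ![1, -Complex.I] k else 0) *
        conj (if n = i then ![1, -Complex.I] l else 0) * K m n := by
    funext k l
    fin_cases k <;> fin_cases l <;> simp [apply_ite]
  rw [e1, e2]
  exact hmap

theorem indepFun_re_im (h : IsCircularGaussian μ g K) {i : ι} (hK : (K i i).im = 0) :
    IndepFun (fun ω => (g i ω).re) (fun ω => (g i ω).im) μ := by
  refine HasGaussianLaw.indepFun_of_covariance_eq_zero ?_ ?_
  · exact (h.hasGaussianLaw.eval i).map (Complex.reCLM.prod Complex.imCLM)
  · have := (h.rotation i).covariance_re_re 0 1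
    simpa [hK] using this

theorem variance_re (h : IsCircularGaussian μ g K) (i : ι) :
    Var[fun ω => (g i ω).re; μ] = (K i i).re / 2 := by
  rw [← covariance_self (h.memLp_re i).aemeasurable, h.covariance_re_re]

theorem map_re (h : IsCircularGaussian μ g K) (i : ι) :
    μ.map (fun ω => (g i ω).re) = gaussianReal 0 ((K i i).re / 2).toNNReal := by
  have hg : HasGaussianLaw (fun ω => (g i ω).re) μ :=
    (h.hasGaussianLaw.eval i).map Complex.reCLM
  rw [hg.map_eq_gaussianReal, h.variance_re, h.integral_re]

theorem map_im (h : IsCircularGaussian μ g K) (i : ι) :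
    μ.map (fun ω => (g i ω).im) = gaussianReal 0 ((K i i).re / 2).toNNReal := by
  have := (h.rotation i).map_re 1
  simpa using this

theorem map_le_smul_volume (h : IsCircularGaussian μ g K) {i : ι} {τ : ℝ} (hτ : 0 < τ)
    (hK : K i i = τ) :
    μ.map (g i) ≤ ENNReal.ofReal (1 / (Real.pi * τ)) • (volume : Measure ℂ) := by
  have := h.hasGaussianLaw.isProbabilityMeasure
  have hg : AEMeasurable (g i) μ := (h.hasGaussianLaw.eval i).aemeasurable
  have hv : (τ / 2).toNNReal ≠ 0 := by
    rw [ne_eq, Real.toNNReal_eq_zero, not_le]; positivity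
  have hre : AEMeasurable (fun ω => (g i ω).re) μ := hg.re
  have him : AEMeasurable (fun ω => (g i ω).im) μ := hg.im
  have hind := (h.indepFun_re_im (i := i) (by simp [hK])).map_prod_eq_prod_map_map
    hre him
  set c : ℝ≥0∞ := ENNReal.ofReal (1 / √(2 * Real.pi * (τ / 2).toNNReal)) with hc
  have hcc : c * c = ENNReal.ofReal (1 / (Real.pi * τ)) := by
    rw [hc, ← ENNReal.ofReal_mul (by positivity), div_mul_div_comm, Real.mul_self_sqrt
      (by positivity), Real.coe_toNNReal _ (by positivity)]
    congr 1
    field_simp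
  have hle : μ.map (fun ω => ((g i ω).re, (g i ω).im)) ≤
      ENNReal.ofReal (1 / (Real.pi * τ)) • (volume : Measure (ℝ × ℝ)) := by
    rw [hind, h.map_re, h.map_im, hK, Complex.ofReal_re]
    refine (Measure.prod_mono (gaussianReal_le_smul_volume 0 hv)
      (gaussianReal_le_smul_volume 0 hv)).trans_eq ?_
    rw [Measure.prod_smul_left, Measure.prod_smul_right, smul_smul, ← hc, hcc,
      Measure.volume_eq_prod]
  have hmap : μ.map (g i) = (μ.map (fun ω => ((g i ω).re, (g i ω).im))).map
      Complex.measurableEquivRealProd.symm := by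
    rw [AEMeasurable.map_map_of_aemeasurable
      Complex.measurableEquivRealProd.symm.measurable.aemeasurable (hre.prodMk him)]
    rfl
  rw [hmap, ← Complex.volume_preserving_equiv_real_prod.symm.map_eq, ← Measure.map_smul]
  exact Measure.map_mono hle Complex.measurableEquivRealProd.symm.measurable

end IsCircularGaussian

/-- The area of an annulus given by a quadratic inequality. -/
theorem volume_abs_quadratic_le (q t b : ℝ) (p : ℂ) (hq : q ≠ 0) (hb : 0 ≤ b) :
    volume {y : ℂ | |q * ‖y - p‖ ^ 2 + t| ≤ b} ≤ ENNReal.ofReal (Real.pi * (2 * b / |q|)) := by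
  set s := -t / q with hs
  set r := b / |q| with hr
  have hq' : 0 < |q| := abs_pos.2 hq
  have hr0 : 0 ≤ r := by positivity
  have hmem : ∀ y : ℂ, |q * ‖y - p‖ ^ 2 + t| ≤ b → |‖y - p‖ ^ 2 - s| ≤ r := by
    intro y hy
    have : q * ‖y - p‖ ^ 2 + t = q * (‖y - p‖ ^ 2 - s) := by
      rw [hs]; field_simp; ring
    rw [this, abs_mul] at hy
    rw [hr, le_div_iff₀ hq']
    linarith
  rcases lt_or_ge (s + r) 0 with hneg | hpos
  · have : {y : ℂ | |q * ‖y - p‖ ^ 2 + t| ≤ b} = ∅ := by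
      refine Set.eq_empty_of_forall_notMem fun y hy => ?_
      have h1 := (abs_le.1 (hmem y hy)).2
      have h2 : 0 ≤ ‖y - p‖ ^ 2 := by positivity
      linarith
    simp [this]
  · set m := max 0 (s - r) with hm
    have hm0 : 0 ≤ m := le_max_left _ _
    have hle : m ≤ s + r := max_le hpos (by linarith)
    have hsub : {y : ℂ | |q * ‖y - p‖ ^ 2 + t| ≤ b} ⊆
        Metric.closedBall p (√(s + r)) \ Metric.ball p (√m) := by
      intro y hy
      have h1 := abs_le.1 (hmem y hy)
      refine ⟨?_, ?_⟩
      · rw [mem_closedBall_iff_norm]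
        exact Real.le_sqrt_of_sq_le (by linarith)
      · rw [mem_ball_iff_norm, not_lt]
        exact (Real.sqrt_le_left (norm_nonneg _)).2 (max_le (by positivity) (by linarith))
    refine (measure_mono hsub).trans ?_
    rw [measure_sdiff (Metric.ball_subset_closedBall.trans
      (Metric.closedBall_subset_closedBall (Real.sqrt_le_sqrt hle)))
      measurableSet_ball.nullMeasurableSet measure_ball_lt_top.ne,
      Complex.volume_closedBall, Complex.volume_ball, ← ENNReal.ofReal_pow (Real.sqrt_nonneg _),
      ← ENNReal.ofReal_pow (Real.sqrt_nonneg _), Real.sq_sqrt hpos, Real.sq_sqrt hm0,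
      ← ENNReal.sub_mul (fun _ _ => ENNReal.coe_ne_top), ← ENNReal.ofReal_sub _ hm0,
      ← NNReal.coe_real_pi, ← ENNReal.ofReal_coe_nnreal, ← ENNReal.ofReal_mul (by linarith)]
    refine ENNReal.ofReal_le_ofReal ?_
    rw [mul_comm]
    refine mul_le_mul_of_nonneg_left ?_ (NNReal.coe_nonneg _)
    have : s - r ≤ m := le_max_right _ _
    rw [mul_div_assoc, ← hr]
    linarith

theorem measure_mem_le_of_indepFun {Ω E : Type*} [MeasurableSpace Ω] [MeasurableSpace E]
    {μ : Measure Ω} [IsProbabilityMeasure μ] {T : Ω → E} {W : Ω → ℂ}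
    (hind : IndepFun T W μ) (hT : AEMeasurable T μ) (hW : AEMeasurable W μ) {a c : ℝ≥0∞}
    (hle : μ.map W ≤ c • volume) {S : Set (E × ℂ)} (hS : MeasurableSet S) {B : Set E}
    (hB : MeasurableSet B) (hSB : ∀ t w, (t, w) ∈ S → t ∈ B)
    (ha : ∀ t, volume (Prod.mk t ⁻¹' S) ≤ a) :
    μ {ω | (T ω, W ω) ∈ S} ≤ c * a * μ.map T B := by
  have h1 : μ {ω | (T ω, W ω) ∈ S} = μ.map (fun ω => (T ω, W ω)) S :=
    (Measure.map_apply_of_aemeasurable (hT.prodMk hW) hS).symm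
  rw [h1, hind.map_prod_eq_prod_map_map hT hW, Measure.prod_apply hS]
  calc ∫⁻ t, μ.map W (Prod.mk t ⁻¹' S) ∂μ.map T
      ≤ ∫⁻ t, B.indicator (fun _ => c * a) t ∂μ.map T := by
        refine lintegral_mono fun t => ?_
        by_cases ht : t ∈ B
        · rw [Set.indicator_of_mem ht]
          refine (hle _).trans ?_
          rw [Measure.smul_apply, smul_eq_mul]
          gcongr
          exact ha t
        · have : Prod.mk t ⁻¹' S = ∅ :=
            Set.eq_empty_of_forall_notMem fun w hw => ht (hSB t w hw)
          simp [this]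
    _ = c * a * μ.map T B := by rw [lintegral_indicator hB, setLIntegral_const]

/-- Completing the square in `y ↦ det (A + σ y, B + σ c y)`. -/
theorem im_conj_mul_eq_quadratic (A B c : ℂ) {σ : ℝ} (hσ : σ ≠ 0) (hc : c.im ≠ 0) :
    ∃ (p : ℂ) (t : ℝ), ∀ y : ℂ,
      (conj (A + σ * y) * (B + σ * (c * y))).im = σ ^ 2 * c.im * ‖y - p‖ ^ 2 + t := by
  set d : ℂ := σ * Complex.I * (A * conj c - B) with hd
  refine ⟨-d / (2 * (σ ^ 2 * c.im : ℝ)), (conj A * B).im - ‖d‖ ^ 2 / (4 * (σ ^ 2 * c.im)),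
    fun y => ?_⟩
  have hq : σ ^ 2 * c.im ≠ 0 := mul_ne_zero (pow_ne_zero _ hσ) hc
  have e : -d / (2 * (σ ^ 2 * c.im : ℝ)) = ((-1 / (2 * (σ ^ 2 * c.im)) : ℝ) : ℂ) * d := by
    push_cast; ring
  rw [e, ← Complex.normSq_eq_norm_sq, ← Complex.normSq_eq_norm_sq]
  set x : ℝ := -1 / (2 * (σ ^ 2 * c.im)) with hx
  have hxq : σ ^ 2 * c.im * x = -1 / 2 := by rw [hx]; field_simp
  have hx2 : Complex.normSq d / (4 * (σ ^ 2 * c.im)) =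
      σ ^ 2 * c.im * x ^ 2 * Complex.normSq d := by
    rw [hx]; field_simp; ring
  rw [hx2]
  have h1 : σ ^ 2 * c.im * Complex.normSq (y - x * d) =
      σ ^ 2 * c.im * Complex.normSq y + (y.re * d.re + y.im * d.im) +
        σ ^ 2 * c.im * x ^ 2 * Complex.normSq d := by
    simp only [Complex.normSq_apply, Complex.sub_re, Complex.sub_im, Complex.re_ofReal_mul,
      Complex.im_ofReal_mul]
    linear_combination (-2) * (y.re * d.re + y.im * d.im) * hxq
  rw [h1, hd]
  simp only [Complex.normSq_apply, Complex.mul_im, Complex.mul_re, Complex.add_re, Complex.add_im,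
    Complex.conj_re, Complex.conj_im, Complex.ofReal_re, Complex.ofReal_im, Complex.I_re,
    Complex.I_im, Complex.sub_re, Complex.sub_im]
  ring

/-- Probability that a Gaussian triple is close to zero and almost flat. -/
theorem IsCircularGaussian.measure_norm_le_and_abs_im_le {Ω : Type*} [MeasurableSpace Ω]
    {μ : Measure Ω} {g : Fin 3 → Ω → ℂ} {K : Fin 3 → Fin 3 → ℂ} (h : IsCircularGaussian μ g K)
    (h00 : K 0 0 = 1) (h11 : K 1 1 = 1) (h10 : ‖K 1 0‖ < 1) {κ : ℝ}
    (hκ : κ = (K 2 1 - K 2 0 * K 0 1).im) (hκ0 : κ ≠ 0) (m : Fin 3 → ℂ) {σ a b : ℝ} (hσ : 0 < σ)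
    (ha : 0 ≤ a) (hb : 0 ≤ b) :
    μ {ω | ‖m 0 + σ * g 0 ω‖ ≤ a ∧
      |(conj ((m 1 + σ * g 1 ω) - (m 0 + σ * g 0 ω)) *
        ((m 2 + σ * g 2 ω) - (m 0 + σ * g 0 ω))).im| ≤ b} ≤
      ENNReal.ofReal (2 * a ^ 2 * b / (σ ^ 4 * |κ|)) := by
  have := h.hasGaussianLaw.isProbabilityMeasure
  set r := K 1 0 with hr
  have h01 : K 0 1 = conj r := (h.conj_covariance 1 0).symm
  set τ : ℝ := 1 - Complex.normSq r with hτ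
  have hτ0 : 0 < τ := by
    rw [hτ, Complex.normSq_eq_norm_sq]
    nlinarith [norm_nonneg r]
  have hτC : (τ : ℂ) = 1 - r * conj r := by rw [hτ, Complex.mul_conj]; push_cast; rfl
  have hτC0 : (τ : ℂ) ≠ 0 := by exact_mod_cast hτ0.ne'
  set c : ℂ := (K 2 1 - K 2 0 * conj r) / τ with hc
  have hcim : c.im = κ / τ := by rw [hc, Complex.div_ofReal_im, hκ, h01]
  have hcim0 : c.im ≠ 0 := by rw [hcim]; exact div_ne_zero hκ0 hτ0.ne'
  let A : Fin 3 → Fin 3 → ℂ := ![![1, 0, 0], ![-r, 1, 0], ![c * r, -c, 1]]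
  have hA := h.map A
  set g' : Fin 3 → Ω → ℂ := fun k ω => ∑ i, A k i * g i ω with hg'
  set K' : Fin 3 → Fin 3 → ℂ := fun k l => ∑ j, ∑ i, A k i * conj (A l j) * K i j with hK'
  have k01 : K' 0 1 = 0 := by
    simp [hK', A, Fin.sum_univ_three, h00, h01]
  have k00 : K' 0 0 = (1 : ℝ) := by
    simp [hK', A, Fin.sum_univ_three, h00]
  have k11 : K' 1 1 = τ := by
    simp [hK', A, Fin.sum_univ_three, h00, h01, h11, hτC, ← hr]
    ring
  have k21 : K' 2 1 = 0 := by
    have : c * τ = K 2 1 - K 2 0 * conj r := by rw [hc]; field_simp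
    simp [hK', A, Fin.sum_univ_three, h00, h01, h11, ← hr]
    rw [hτC] at this
    linear_combination -this
  have g0 : ∀ ω, g 0 ω = g' 0 ω := fun ω => by simp [hg', A, Fin.sum_univ_three]
  have g1 : ∀ ω, g 1 ω = r * g' 0 ω + g' 1 ω := fun ω => by
    simp [hg', A, Fin.sum_univ_three]
  have g2 : ∀ ω, g 2 ω = g' 2 ω + c * g' 1 ω := fun ω => by
    simp [hg', A, Fin.sum_univ_three]; ring
  have hm : ∀ i, AEMeasurable (g' i) μ := fun i => (hA.hasGaussianLaw.eval i).aemeasurable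
  let B : Set (ℂ × ℂ) := {t | ‖m 0 + σ * t.1‖ ≤ a}
  let S : Set ((ℂ × ℂ) × ℂ) := {u | ‖m 0 + σ * u.1.1‖ ≤ a ∧
    |(conj ((m 1 - m 0 + σ * ((r - 1) * u.1.1)) + σ * u.2) *
      ((m 2 - m 0 + σ * (u.1.2 - u.1.1)) + σ * (c * u.2))).im| ≤ b}
  have hB : MeasurableSet B :=
    (isClosed_le (by fun_prop) (by fun_prop)).measurableSet
  have hS : MeasurableSet S := by
    refine IsClosed.measurableSet ?_
    have h1 : Continuous fun u : (ℂ × ℂ) × ℂ => ‖m 0 + σ * u.1.1‖ := by fun_prop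
    have h2 : Continuous fun u : (ℂ × ℂ) × ℂ =>
        |(conj ((m 1 - m 0 + σ * ((r - 1) * u.1.1)) + σ * u.2) *
          ((m 2 - m 0 + σ * (u.1.2 - u.1.1)) + σ * (c * u.2))).im| := by
      refine continuous_abs.comp (Complex.continuous_im.comp ?_)
      refine (Complex.continuous_conj.comp ?_).mul ?_ <;> fun_prop
    exact (isClosed_le h1 continuous_const).inter (isClosed_le h2 continuous_const)
  have key := measure_mem_le_of_indepFun (hA.indepFun_prodMk k01 k21) ((hm 0).prodMk (hm 2)) (hm 1)
    (a := ENNReal.ofReal (Real.pi * (2 * b / |σ ^ 2 * c.im|)))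
    (hA.map_le_smul_volume hτ0 k11) hS hB (fun t w hw => hw.1) (fun t => by
      obtain ⟨p, s, hps⟩ := im_conj_mul_eq_quadratic (m 1 - m 0 + σ * ((r - 1) * t.1))
        (m 2 - m 0 + σ * (t.2 - t.1)) c hσ.ne' hcim0
      refine (measure_mono ?_).trans (volume_abs_quadratic_le (σ ^ 2 * c.im) s b p
        (mul_ne_zero (by positivity) hcim0) hb)
      intro y hy
      have := hy.2
      rwa [hps] at this)
  have hBm : μ.map (fun ω => (g' 0 ω, g' 2 ω)) B ≤ ENNReal.ofReal (a ^ 2 / σ ^ 2) := by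
    have e : μ.map (fun ω => (g' 0 ω, g' 2 ω)) B =
        μ.map (g' 0) (Metric.closedBall (-m 0 / σ) (a / σ)) := by
      rw [Measure.map_apply_of_aemeasurable ((hm 0).prodMk (hm 2)) hB,
        Measure.map_apply_of_aemeasurable (hm 0) measurableSet_closedBall]
      congr 1
      ext ω
      have hσC : (σ : ℂ) ≠ 0 := by exact_mod_cast hσ.ne'
      have : m 0 + σ * g' 0 ω = σ * (g' 0 ω - -m 0 / σ) := by field_simp; ring
      simp only [B, Set.mem_preimage, Set.mem_ofPred_eq, mem_closedBall_iff_norm]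
      rw [this, norm_mul, Complex.norm_real, Real.norm_of_nonneg hσ.le, le_div_iff₀ hσ, mul_comm]
    rw [e]
    refine (hA.map_le_smul_volume one_pos k00 _).trans ?_
    rw [Measure.smul_apply, smul_eq_mul, Complex.volume_closedBall,
      ← ENNReal.ofReal_pow (by positivity), ← NNReal.coe_real_pi, ← ENNReal.ofReal_coe_nnreal,
      ← ENNReal.ofReal_mul (by positivity), ← ENNReal.ofReal_mul (by positivity)]
    refine ENNReal.ofReal_le_ofReal (le_of_eq ?_)
    rw [NNReal.coe_real_pi]
    have := Real.pi_ne_zero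
    field_simp
  calc _ ≤ μ {ω | ((g' 0 ω, g' 2 ω), g' 1 ω) ∈ S} := by
        refine measure_mono fun ω hω => ?_
        simp only [Set.mem_ofPred_eq, g0, g1, g2] at hω
        refine ⟨hω.1, ?_⟩
        convert hω.2 using 5 <;> ring
    _ ≤ _ := key
    _ ≤ _ := mul_le_mul_right hBm _
    _ = _ := by
      rw [← ENNReal.ofReal_mul (by positivity), ← ENNReal.ofReal_mul (by positivity)]
      congr 1
      rw [hcim, abs_mul, abs_div, abs_of_pos hτ0, abs_of_pos (pow_pos hσ 2)]
      have := abs_ne_zero.2 hκ0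
      have := Real.pi_ne_zero
      field_simp

/-! ### Nondegeneracy of the twisted covariance at small scales -/

theorem tendsto_div_sq_of_odd {ψ : ℝ → ℝ} (hψ : ContDiff ℝ 2 ψ) (hodd : ∀ t, ψ (-t) = -ψ t)
    (hd : deriv ψ 0 = 0) : Tendsto (fun t => ψ t / t ^ 2) (𝓝 0) (𝓝 0) := by
  have h0 : ψ 0 = 0 := by
    have := hodd 0
    rw [neg_zero] at this
    linarith
  have h2 : iteratedDeriv 2 ψ 0 = 0 := by
    have h := iteratedDeriv_comp_neg 2 ψ 0
    have e : (fun t => ψ (-t)) = fun t => -ψ t := funext hodd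
    rw [e, iteratedDeriv_fun_neg] at h
    simp at h
    linarith
  have h := taylor_isLittleO_univ (x₀ := 0) (n := 2) hψ
  refine (h.tendsto_div_nhds_zero).congr fun t => ?_
  simp [taylorWithinEval_succ, h0, h2, iteratedDerivWithin_univ, hd]

theorem tendsto_im_covariance_div_sq {H : ℂ → ℂ} (hH : ContDiff ℝ 2 H) (h0 : H 0 = 1)
    (hconj : ∀ z, H (-z) = conj (H z)) :
    Tendsto (fun h : ℝ => (H (Complex.I * h - h) * Complex.exp (Complex.I * ((h ^ 2 : ℝ) : ℂ)) -
      H (Complex.I * h) * H (-h)).im / h ^ 2) (𝓝[≠] 0) (𝓝 1) := by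
  have hline : ∀ v : ℂ, ContDiff ℝ 2 fun t : ℝ => H (v * t) := fun v =>
    hH.comp (contDiff_const.mul Complex.ofRealCLM.contDiff)
  have him : ∀ v : ℂ, ContDiff ℝ 2 fun t : ℝ => (H (v * t)).im := fun v =>
    Complex.imCLM.contDiff.comp (hline v)
  have hre : ∀ v : ℂ, ContDiff ℝ 2 fun t : ℝ => (H (v * t)).re := fun v =>
    Complex.reCLM.contDiff.comp (hline v)
  have him_odd : ∀ (v : ℂ) (t : ℝ), (H (v * (-t : ℝ))).im = -(H (v * t)).im := fun v t => by
    rw [Complex.ofReal_neg, mul_neg, hconj, Complex.conj_im]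
  have hre_even : ∀ (v : ℂ) (t : ℝ), (H (v * (-t : ℝ))).re = (H (v * t)).re := fun v t => by
    rw [Complex.ofReal_neg, mul_neg, hconj, Complex.conj_re]
  have hre_deriv : ∀ v : ℂ, deriv (fun t : ℝ => (H (v * t)).re) 0 = 0 := fun v => by
    have h := deriv_comp_neg (fun t : ℝ => (H (v * t)).re) 0
    simp_rw [hre_even] at h
    rw [neg_zero] at h
    linarith
  have hd : ∀ v : ℂ, HasDerivAt (fun t : ℝ => (H (v * t)).im) ((fderiv ℝ H 0 v).im) 0 := fun v => by
    have h1 : HasDerivAt (fun t : ℝ => v * (t : ℂ)) v 0 := by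
      simpa using (Complex.ofRealCLM.hasDerivAt (x := (0 : ℝ))).const_mul v
    have h2 : HasFDerivAt H (fderiv ℝ H 0) (v * ((0 : ℝ) : ℂ)) := by
      simpa using (hH.differentiable (by norm_num) 0).hasFDerivAt
    have h3 : HasDerivAt (fun t : ℝ => H (v * t)) (fderiv ℝ H 0 v) 0 := h2.comp_hasDerivAt 0 h1
    exact Complex.imCLM.hasFDerivAt.comp_hasDerivAt 0 h3
  set ψ : ℝ → ℝ := fun t => (H ((Complex.I - 1) * t)).im - (H (Complex.I * t)).im -
    (H (-1 * t)).im with hψ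
  have t1 : Tendsto (fun t => ψ t / t ^ 2) (𝓝[≠] 0) (𝓝 0) := by
    refine (tendsto_div_sq_of_odd (((him _).sub (him _)).sub (him _)) (fun t => ?_) ?_).mono_left
      nhdsWithin_le_nhds
    · simp only [him_odd]; ring
    · refine (((hd (Complex.I - 1)).fun_sub (hd Complex.I)).fun_sub (hd (-1))).deriv.trans ?_
      simp
  have cim : ∀ v : ℂ, Tendsto (fun t : ℝ => (H (v * t)).im) (𝓝[≠] 0) (𝓝 0) := fun v => by
    have := ((him v).continuous.tendsto 0).mono_left (nhdsWithin_le_nhds (s := {0}ᶜ))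
    simpa [h0] using this
  have cre : ∀ v : ℂ, Tendsto (fun t : ℝ => (H (v * t)).re) (𝓝[≠] 0) (𝓝 1) := fun v => by
    have := ((hre v).continuous.tendsto 0).mono_left (nhdsWithin_le_nhds (s := {0}ᶜ))
    simpa [h0] using this
  have sim : ∀ v : ℂ, Tendsto (fun t : ℝ => (H (v * t)).im / t) (𝓝[≠] 0)
      (𝓝 ((fderiv ℝ H 0 v).im)) := fun v => by
    have := (hasDerivAt_iff_tendsto_slope_zero.1 (hd v))
    simpa [h0, div_eq_inv_mul] using this
  have sre : ∀ v : ℂ, Tendsto (fun t : ℝ => ((H (v * t)).re - 1) / t) (𝓝[≠] 0) (𝓝 0) := fun v => by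
    have h := ((hre v).differentiable (by norm_num) 0).hasDerivAt
    rw [hre_deriv] at h
    have := hasDerivAt_iff_tendsto_slope_zero.1 h
    simpa [h0, div_eq_inv_mul] using this
  have hsq : Tendsto (fun t : ℝ => t ^ 2) (𝓝[≠] 0) (𝓝[≠] 0) := by
    refine tendsto_nhdsWithin_iff.2 ⟨?_, ?_⟩
    · have : Tendsto (fun t : ℝ => t ^ 2) (𝓝 0) (𝓝 (0 ^ 2)) := (continuous_pow 2).tendsto 0
      simpa using this.mono_left nhdsWithin_le_nhds
    · filter_upwards [self_mem_nhdsWithin] with t ht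
      exact pow_ne_zero 2 ht
  have tsin : Tendsto (fun t : ℝ => Real.sin (t ^ 2) / t ^ 2) (𝓝[≠] 0) (𝓝 1) := by
    have := (hasDerivAt_iff_tendsto_slope_zero.1 (Real.hasDerivAt_sin 0)).comp hsq
    simpa [div_eq_inv_mul, Function.comp_def] using this
  have tcos : Tendsto (fun t : ℝ => (Real.cos (t ^ 2) - 1) / t ^ 2) (𝓝[≠] 0) (𝓝 0) := by
    have := (hasDerivAt_iff_tendsto_slope_zero.1 (Real.hasDerivAt_cos 0)).comp hsq
    simpa [div_eq_inv_mul, Function.comp_def] using this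
  have T := (((t1.add ((cim (Complex.I - 1)).mul tcos)).add ((cre (Complex.I - 1)).mul tsin)).sub
    ((sre Complex.I).mul (sim (-1)))).sub ((sim Complex.I).mul (sre (-1)))
  have e1 : (0 : ℝ) + 0 * 0 + 1 * 1 - 0 * (fderiv ℝ H 0 (-1)).im -
    (fderiv ℝ H 0 Complex.I).im * 0 = 1 := by ring
  rw [e1] at T
  refine T.congr' ?_
  filter_upwards [self_mem_nhdsWithin] with t ht
  have ht' : t ≠ 0 := ht
  have a1 : Complex.I * (t : ℂ) - t = (Complex.I - 1) * t := by ring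
  have a2 : (-(t : ℂ)) = -1 * t := by ring
  have a3 : Complex.exp (Complex.I * ((t ^ 2 : ℝ) : ℂ)) =
      ⟨Real.cos (t ^ 2), Real.sin (t ^ 2)⟩ := by
    rw [mul_comm, Complex.exp_mul_I]
    apply Complex.ext <;> simp [← Complex.ofReal_cos, ← Complex.ofReal_sin, -Complex.ofReal_pow]
  rw [a1, a2, a3]
  simp only [hψ, Complex.sub_im, Complex.mul_im]
  field_simp
  ring

/-! ### The twisted shift of the Gaussian field -/

section Field

variable {Ω : Type*} [MeasurableSpace Ω] {μ : Measure Ω} {H : ℂ → ℂ} {F₀ : ℂ → Ω → ℂ}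

theorem IsTwistedGaussianField.pseudo_covariance (hF : IsTwistedGaussianField μ H F₀) (z w : ℂ) :
    ∫ ω, F₀ z ω * F₀ w ω ∂μ = 0 := by
  classical
  have hm := hF.isGaussianProcess.aemeasurable
  let I : Finset ℂ := {z, w}
  let f : (I → ℂ) → ℂ := fun x => x ⟨z, by simp [I]⟩ * x ⟨w, by simp [I]⟩
  have hf : Measurable f := by fun_prop
  have hc : ∫ x, f x ∂μ.map _ = ∫ x, f x ∂μ.map _ :=
    congrArg (fun ν => ∫ x, f x ∂ν) (hF.circular I (Real.pi / 2))
  rw [integral_map (aemeasurable_pi_lambda _ fun i : I => (hm i).const_mul _)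
      hf.aestronglyMeasurable,
    integral_map (aemeasurable_pi_lambda _ fun i : I => hm i) hf.aestronglyMeasurable] at hc
  have e : Complex.exp (Complex.I * ((Real.pi / 2 : ℝ) : ℂ)) = Complex.I := by
    rw [mul_comm]; push_cast; exact Complex.exp_pi_div_two_mul_I
  have e2 : ∀ ω, Complex.I * F₀ z ω * (Complex.I * F₀ w ω) = -(F₀ z ω * F₀ w ω) := fun ω => by
    linear_combination F₀ z ω * F₀ w ω * Complex.I_mul_I
  simp only [f, e, e2, integral_neg] at hc
  exact self_eq_neg.1 hc.symm

theorem IsTwistedGaussianField.kernel_neg [IsProbabilityMeasure μ]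
    (hF : IsTwistedGaussianField μ H F₀) (z : ℂ) : H (-z) = conj (H z) := by
  have h1 := hF.covariance 0 z
  have h2 := hF.covariance z 0
  simp only [zero_sub, sub_zero, zero_mul, map_zero, mul_zero, Complex.zero_im, Complex.ofReal_zero,
    Complex.exp_zero, mul_one] at h1 h2
  rw [← h1, ← h2, ← integral_conj]
  simp [mul_comm]

/-- The twisted shifts of the field have the same covariance as the field itself. -/
theorem IsTwistedGaussianField.isCircularGaussian_twistedShift
    (hF : IsTwistedGaussianField μ H F₀) (lam : ℂ) {ι : Type*} [Fintype ι] (t : ι → ℂ) :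
    IsCircularGaussian μ (fun i ω => twistedShift (fun z => F₀ z ω) lam (t i))
      (fun i j => H (t i - t j) * Complex.exp (Complex.I * ((t i * conj (t j)).im : ℂ))) where
  hasGaussianLaw := by
    classical
    let J : Finset ℂ := Finset.univ.image fun i => t i + lam
    let T : (J → ℂ) →L[ℝ] (ι → ℂ) := ContinuousLinearMap.pi fun i =>
      ((ContinuousLinearMap.mul ℝ ℂ).flip
        (Complex.exp (-Complex.I * ((t i * conj lam).im : ℂ)))).comp
        (ContinuousLinearMap.proj ⟨t i + lam, by simp [J]⟩)
    exact (hF.isGaussianProcess.hasGaussianLaw J).map T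
  mean_zero i := by
    simp only [twistedShift]
    rw [integral_mul_const, hF.mean_zero, zero_mul]
  pseudo_covariance i j := by
    simp only [twistedShift]
    simp_rw [mul_mul_mul_comm]
    rw [integral_mul_const, hF.pseudo_covariance, zero_mul]
  covariance i j := by
    simp only [twistedShift]
    simp_rw [map_mul, mul_mul_mul_comm]
    rw [integral_mul_const, hF.covariance, ← Complex.exp_conj, ← Complex.exp_add, mul_assoc,
      ← Complex.exp_add]
    have e1 : t i + lam - (t j + lam) = t i - t j := by ring
    rw [e1]
    congr 2
    simp only [map_mul, map_neg, Complex.conj_I, Complex.conj_ofReal, neg_neg, map_add]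
    have : (((t i + lam) * (conj (t j) + conj lam)).im : ℂ) - ((t i * conj lam).im : ℂ) +
        ((t j * conj lam).im : ℂ) = ((t i * conj (t j)).im : ℂ) := by
      norm_cast
      simp only [Complex.mul_im, Complex.add_im, Complex.add_re, Complex.conj_im, Complex.conj_re]
      ring
    rw [← this]
    ring

end Field

/-! ### Finite differences -/

theorem det_eq_im_conj_mul (T : ℂ →L[ℝ] ℂ) : T.det = (conj (T 1) * T Complex.I).im := by
  rw [ContinuousLinearMap.det, ← LinearMap.det_toMatrix Complex.basisOneI, Matrix.det_fin_two]
  simp [LinearMap.toMatrix_apply]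
  ring

theorem tendsto_im_difference_quotient {f : ℂ → ℂ} (hf : DifferentiableAt ℝ f 0) :
    Tendsto (fun h : ℝ => (conj (f h - f 0) * (f (Complex.I * h) - f 0)).im / h ^ 2) (𝓝[≠] 0)
      (𝓝 (jacobianDet f 0)) := by
  have hl : ∀ v : ℂ, Tendsto (fun h : ℝ => (h : ℂ)⁻¹ * (f (v * h) - f 0)) (𝓝[≠] 0)
      (𝓝 (fderiv ℝ f 0 v)) := fun v => by
    have := (hf.hasFDerivAt.hasLineDerivAt v).tendsto_slope_zero
    simpa [mul_comm] using this
  rw [jacobianDet, det_eq_im_conj_mul]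
  refine ((Complex.continuous_im.tendsto _).comp
    (((Complex.continuous_conj.tendsto _).comp (hl 1)).mul (hl Complex.I))).congr' ?_
  filter_upwards [self_mem_nhdsWithin] with h hh
  have e : conj ((h : ℂ)⁻¹ * (f (1 * h) - f 0)) * ((h : ℂ)⁻¹ * (f (Complex.I * h) - f 0)) =
      conj (f h - f 0) * (f (Complex.I * h) - f 0) / ((h ^ 2 : ℝ) : ℂ) := by
    rw [map_mul, map_inv₀, Complex.conj_ofReal, one_mul]
    push_cast
    field_simp
  simp only [Function.comp_apply]
  rw [e, Complex.div_ofReal_im]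

theorem measure_le_of_ae_eventually {Ω : Type*} [MeasurableSpace Ω] {μ : Measure Ω} {S : Set Ω}
    {A : ℕ → Set Ω} {c : ℝ≥0∞} (hS : ∀ᵐ ω ∂μ, ω ∈ S → ∀ᶠ n in atTop, ω ∈ A n)
    (hA : ∀ᶠ n in atTop, μ (A n) ≤ c) : μ S ≤ c := by
  have h1 : μ S ≤ μ (⋃ N, ⋂ n ≥ N, A n) := by
    refine measure_mono_ae ?_
    filter_upwards [hS] with ω hω hωS
    obtain ⟨N, hN⟩ := eventually_atTop.1 (hω hωS)
    exact Set.mem_iUnion.2 ⟨N, Set.mem_iInter₂.2 hN⟩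
  have hmono : Monotone fun N => ⋂ n ≥ N, A n := fun M N hMN =>
    Set.biInter_subset_biInter_left fun n hn => le_trans hMN hn
  rw [hmono.measure_iUnion] at h1
  refine h1.trans (iSup_le fun N => ?_)
  obtain ⟨n, hn, hNn⟩ := (hA.and (eventually_ge_atTop N)).exists
  exact (measure_mono (Set.biInter_subset_of_mem hNn)).trans hn

theorem twistedShift_input {Ω : Type*} (F₁ : ℂ → ℂ) (σ : ℝ) (F₀ : ℂ → Ω → ℂ) (ω : Ω) (lam z : ℂ) :
    twistedShift (input F₁ σ F₀ ω) lam z =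
      twistedShift F₁ lam z + σ * twistedShift (fun w => F₀ w ω) lam z := by
  simp only [twistedShift, input]
  ring

theorem differentiable_twistedShift {F : ℂ → ℂ} (hF : Differentiable ℝ F) (lam : ℂ) :
    Differentiable ℝ (twistedShift F lam) := by
  have h1 : Differentiable ℝ fun z : ℂ => F (z + lam) := hF.comp (differentiable_id.add_const lam)
  have h2 : Differentiable ℝ fun z : ℂ => ((z * conj lam).im : ℂ) :=
    Complex.ofRealCLM.differentiable.comp
      (Complex.imCLM.differentiable.comp (differentiable_id.mul_const _))
  have h3 : Differentiable ℝ fun z : ℂ => Complex.exp (-Complex.I * ((z * conj lam).im : ℂ)) :=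
    (Complex.differentiable_exp (𝕜 := ℝ)).comp (h2.const_mul _)
  exact h1.mul h3

/-- The probability of being almost degenerate at a given point. -/
theorem measure_almostDegenerate_le {Ω : Type*} [MeasurableSpace Ω] {μ : Measure Ω}
    [IsProbabilityMeasure μ] {H : ℂ → ℂ} (hH : IsAdmissibleKernel H) {F₀ : ℂ → Ω → ℂ}
    {F₁ : ℂ → ℂ} {σ : ℝ} (hF₀ : IsTwistedGaussianField μ H F₀) (hF₁ : IsAdmissibleMean F₁)
    (hσ : 0 < σ) {α β : ℝ} (hα : 0 < α) (hβ : 0 < β) (lam : ℂ) :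
    μ {ω | AlmostDegenerate (input F₁ σ F₀ ω) α β lam} ≤
      ENNReal.ofReal (8 * α ^ 2 * β / σ ^ 4) := by
  set f : Ω → ℂ → ℂ := fun ω => twistedShift (input F₁ σ F₀ ω) lam with hf
  let A : ℝ → Set Ω := fun h => {ω | ‖f ω 0‖ ≤ α ∧
    |(conj (f ω h - f ω 0) * (f ω (Complex.I * h) - f ω 0)).im| ≤ 2 * β * h ^ 2}
  have hdiff : ∀ᵐ ω ∂μ, DifferentiableAt ℝ (f ω) 0 := by
    filter_upwards [hF₀.contDiff] with ω hω
    refine differentiable_twistedShift ?_ lam 0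
    exact (hF₁.contDiff.differentiable (by norm_num)).add
      ((hω.differentiable (by norm_num)).const_mul _)
  have hseq : Tendsto (fun n : ℕ => 1 / ((n : ℝ) + 1)) atTop (𝓝[≠] 0) :=
    tendsto_nhdsWithin_iff.2 ⟨tendsto_one_div_add_atTop_nhds_zero_nat,
      Eventually.of_forall fun n => (Nat.one_div_pos_of_nat (n := n)).ne'⟩
  refine measure_le_of_ae_eventually (A := fun n : ℕ => A (1 / ((n : ℝ) + 1))) ?_ ?_
  · filter_upwards [hdiff] with ω hω hdeg
    refine hseq.eventually (p := fun h => ω ∈ A h) ?_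
    have hlim := (tendsto_im_difference_quotient hω).abs
    have hlt : |jacobianDet (f ω) 0| < 2 * β := hdeg.2.trans_lt (by linarith)
    filter_upwards [hlim.eventually_lt_const hlt, self_mem_nhdsWithin] with h hh hne
    refine ⟨hdeg.1, ?_⟩
    have hpos : 0 < h ^ 2 := by
      have : h ≠ 0 := hne
      positivity
    rw [abs_div, abs_of_pos hpos, div_lt_iff₀ hpos] at hh
    exact hh.le
  · refine hseq.eventually (p := fun h => μ (A h) ≤ _) ?_
    have hκ := tendsto_im_covariance_div_sq (hH.contDiff.of_le (by norm_num)) hH.map_zero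
      hF₀.kernel_neg
    filter_upwards [hκ.eventually_const_lt (by norm_num : (1 / 2 : ℝ) < 1), self_mem_nhdsWithin]
      with h hh hne
    have hne : h ≠ 0 := hne
    have hpos : 0 < h ^ 2 := by positivity
    set κ : ℝ := (H (Complex.I * h - h) * Complex.exp (Complex.I * ((h ^ 2 : ℝ) : ℂ)) -
      H (Complex.I * h) * H (-h)).im with hκdef
    rw [lt_div_iff₀ hpos] at hh
    have hκpos : 0 < κ := lt_trans (by positivity) hh
    have hG := hF₀.isCircularGaussian_twistedShift lam ![0, (h : ℂ), Complex.I * h]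
    have key := hG.measure_norm_le_and_abs_im_le (κ := κ) (by simp [hH.map_zero])
      (by simp [hH.map_zero, mul_comm]) (by
        simpa using hH.norm_lt_one h (by exact_mod_cast hne)) (by simp [hκdef, sq]) hκpos.ne'
      (fun i => twistedShift F₁ lam (![0, (h : ℂ), Complex.I * h] i)) hσ hα.le
      (b := 2 * β * h ^ 2) (by positivity)
    calc μ (A h) ≤ _ := by
          refine (measure_mono fun ω hω => ?_).trans key
          simpa only [A, hf, twistedShift_input] using! hω
      _ ≤ _ := by
          refine ENNReal.ofReal_le_ofReal ?_
          rw [abs_of_pos hκpos, div_le_div_iff₀ (by positivity) (by positivity)]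
          nlinarith [mul_le_mul_of_nonneg_left hh.le
            (show 0 ≤ 8 * α ^ 2 * β * σ ^ 4 * σ ^ 4 by positivity), pow_pos hσ 4]

/-! ### Counting the points of the sparse grid -/

/-- A point of the sparse grid has one fine coordinate, and the other at distance exactly `δ^{**}`
from the coarse grid. -/
theorem exists_finset_sparseGrid_subset {δ L : ℝ} (hδ : 0 < δ) (hδ1 : δ ≤ 1) (hL : 1 ≤ L) :
    ∃ s : Finset ℂ, sparseGrid δ L ⊆ s ∧ (s.card : ℝ) ≤ 156 * (L ^ 2 * δ ^ (-3 / 2 : ℝ)) := by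
  classical
  set ρ : ℝ := δ ^ (-1 / 2 : ℝ) with hρ
  have hρ0 : 0 < ρ := Real.rpow_pos_of_pos hδ _
  have hρ1 : 1 ≤ ρ := Real.one_le_rpow_of_pos_of_le_one_of_nonpos hδ hδ1 (by norm_num)
  have hρ2 : ρ ^ 2 * δ = 1 := by
    rw [hρ, ← Real.rpow_natCast, ← Real.rpow_mul hδ.le]
    nth_rewrite 2 [← Real.rpow_one δ]
    rw [← Real.rpow_add hδ]
    norm_num
  have hρ3 : δ ^ (-3 / 2 : ℝ) = ρ ^ 3 := by
    rw [hρ, ← Real.rpow_natCast, ← Real.rpow_mul hδ.le]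
    norm_num
  set M : ℤ := 2 * ⌈ρ / 4⌉ with hM
  set N : ℤ := ⌈ρ⌉ with hN
  have hMs : deltaStar δ = M * δ := by rw [deltaStar, hM]; push_cast; rfl
  have hNs : deltaStarStar δ = N * δ := rfl
  have hMlow : ρ / 2 ≤ M := by
    have := Int.le_ceil (ρ / 4)
    rw [hM]; push_cast; linarith
  have hNup : (N : ℝ) ≤ 2 * ρ := by
    have := (Int.ceil_lt_add_one ρ).le
    linarith
  set P : ℕ := ⌊6 * L * ρ⌋₊ with hP
  set Q : ℕ := ⌊L * ρ ^ 2⌋₊ with hQ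
  let I : Finset ((ℤ × ℤ) × ℤ) :=
    (Finset.Icc (-(P : ℤ)) P ×ˢ {N, -N}) ×ˢ Finset.Icc (-(Q : ℤ)) Q
  let u : (ℤ × ℤ) × ℤ → ℂ := fun t =>
    ((δ * (t.1.1 * M + t.1.2 : ℤ) : ℝ) : ℂ) + Complex.I * ((δ * t.2 : ℝ) : ℂ)
  let v : (ℤ × ℤ) × ℤ → ℂ := fun t =>
    ((δ * t.2 : ℝ) : ℂ) + Complex.I * ((δ * (t.1.1 * M + t.1.2 : ℤ) : ℝ) : ℂ)
  have hfine : ∀ b : ℤ, |δ * b| ≤ L → b ∈ Finset.Icc (-(Q : ℤ)) Q := by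
    intro b hb
    rw [abs_mul, abs_of_pos hδ] at hb
    have h1 : |(b : ℝ)| ≤ L * ρ ^ 2 := by
      nlinarith [mul_le_mul_of_nonneg_left hb (sq_nonneg ρ)]
    rw [Finset.mem_Icc]
    have h2 : b.natAbs ≤ Q := Nat.le_floor (by rwa [Nat.cast_natAbs, Int.cast_abs])
    omega
  have hcoarse : ∀ a k : ℤ, |δ * a| ≤ L → |δ * a - deltaStar δ * k| = deltaStarStar δ →
      ∃ s ∈ ({N, -N} : Finset ℤ), k ∈ Finset.Icc (-(P : ℤ)) P ∧ a = k * M + s := by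
    intro a k ha hak
    rw [hMs, hNs] at hak
    have h1 : |((a - k * M : ℤ) : ℝ)| = N := by
      have : δ * a - M * δ * k = δ * ((a - k * M : ℤ) : ℝ) := by push_cast; ring
      rw [this, abs_mul, abs_of_pos hδ, mul_comm] at hak
      exact mul_right_cancel₀ hδ.ne' hak
    have h2 : |a - k * M| = N := by exact_mod_cast h1
    have hN0 : 0 ≤ N := h2 ▸ abs_nonneg _
    refine ⟨a - k * M, ?_, ?_, by ring⟩
    · rcases (abs_eq hN0).1 h2 with h | h <;> simp [h]
    · have h3 : |(a : ℝ)| ≤ L * ρ ^ 2 := by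
        rw [abs_mul, abs_of_pos hδ] at ha
        nlinarith [mul_le_mul_of_nonneg_left ha (sq_nonneg ρ)]
      have h4 : |(k : ℝ)| * M ≤ L * ρ ^ 2 + N := by
        have hM0 : 0 ≤ (M : ℝ) := by linarith
        calc |(k : ℝ)| * M = |(a : ℝ) - ((a - k * M : ℤ) : ℝ)| := by
              push_cast; rw [sub_sub_cancel, abs_mul, abs_of_nonneg hM0]
          _ ≤ |(a : ℝ)| + |((a - k * M : ℤ) : ℝ)| := abs_sub _ _
          _ ≤ L * ρ ^ 2 + N := by rw [h1]; linarith
      have h5 : |(k : ℝ)| ≤ 6 * L * ρ := by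
        have h6 : |(k : ℝ)| * (ρ / 2) ≤ |(k : ℝ)| * M :=
          mul_le_mul_of_nonneg_left hMlow (abs_nonneg _)
        have h7 : ρ ≤ L * ρ ^ 2 := by nlinarith
        have h8 : |(k : ℝ)| * (ρ / 2) ≤ 6 * L * ρ * (ρ / 2) := by nlinarith
        exact le_of_mul_le_mul_right h8 (by positivity)
      rw [Finset.mem_Icc]
      have h9 : k.natAbs ≤ P := Nat.le_floor (by rwa [Nat.cast_natAbs, Int.cast_abs])
      omega
  refine ⟨I.image u ∪ I.image v, ?_, ?_⟩
  · rintro x ⟨⟨a, b, rfl⟩, hxL, lam, ⟨k, j, rfl⟩, hdist⟩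
    simp only [supNorm, Complex.add_re, Complex.add_im, Complex.sub_re, Complex.sub_im,
      Complex.ofReal_re, Complex.ofReal_im, Complex.mul_re, Complex.mul_im, Complex.I_re,
      Complex.I_im, zero_mul, one_mul, mul_zero, sub_zero, add_zero, zero_add] at hxL hdist
    have hbound := max_le_iff.1 hxL
    rw [Finset.coe_union]
    rcases max_choice |δ * a - deltaStar δ * k| |δ * b - deltaStar δ * j| with h | h
    · obtain ⟨s, hs, hk, has⟩ := hcoarse a k hbound.1 (h ▸ hdist)
      refine Or.inl (Finset.mem_coe.2 (Finset.mem_image.2 ⟨((k, s), b), ?_, ?_⟩))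
      · exact Finset.mem_product.2 ⟨Finset.mem_product.2 ⟨hk, hs⟩, hfine b hbound.2⟩
      · simp only [u, has]
    · obtain ⟨s, hs, hk, has⟩ := hcoarse b j hbound.2 (h ▸ hdist)
      refine Or.inr (Finset.mem_coe.2 (Finset.mem_image.2 ⟨((j, s), a), ?_, ?_⟩))
      · exact Finset.mem_product.2 ⟨Finset.mem_product.2 ⟨hk, hs⟩, hfine a hbound.1⟩
      · simp only [v, has]
  · have hI : I.card ≤ ((2 * P + 1) * 2) * (2 * Q + 1) := by
      rw [Finset.card_product, Finset.card_product, Int.card_Icc, Int.card_Icc]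
      gcongr
      · omega
      · exact Finset.card_le_two
      · omega
    have hcard : (I.image u ∪ I.image v).card ≤ 2 * (((2 * P + 1) * 2) * (2 * Q + 1)) := by
      have h1 := Finset.card_union_le (I.image u) (I.image v)
      have h2 := Finset.card_image_le (s := I) (f := u)
      have h3 := Finset.card_image_le (s := I) (f := v)
      omega
    have hP' : (P : ℝ) ≤ 6 * L * ρ := Nat.floor_le (by positivity)
    have hQ' : (Q : ℝ) ≤ L * ρ ^ 2 := Nat.floor_le (by positivity)
    have e1 : (1 : ℝ) ≤ L * ρ := by nlinarith
    have e2 : (1 : ℝ) ≤ L * ρ ^ 2 := by nlinarith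
    calc ((I.image u ∪ I.image v).card : ℝ)
        ≤ 2 * (((2 * P + 1) * 2) * (2 * Q + 1)) := by exact_mod_cast hcard
      _ ≤ 2 * ((13 * (L * ρ) * 2) * (3 * (L * ρ ^ 2))) := by
          gcongr <;> linarith
      _ = 156 * (L ^ 2 * δ ^ (-3 / 2 : ℝ)) := by rw [hρ3]; ring

end GWHF

theorem proposition3p8 (H : ℂ → ℂ) (hH : GWHF.IsAdmissibleKernel H) :
    ∃ C : ℝ, 0 < C ∧
      ∀ (Ω : Type*) [MeasurableSpace Ω] (μ : MeasureTheory.Measure Ω)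
        [MeasureTheory.IsProbabilityMeasure μ] (F₀ : ℂ → Ω → ℂ) (F₁ : ℂ → ℂ) (σ : ℝ),
        GWHF.IsTwistedGaussianField μ H F₀ → GWHF.IsAdmissibleMean F₁ → 0 < σ →
        ∀ α β : ℝ, 0 < α → 0 < β →
          (∀ lam : ℂ,
            μ {ω | GWHF.AlmostDegenerate (GWHF.input F₁ σ F₀ ω) α β lam} ≤
              ENNReal.ofReal (C * α ^ 2 * β * σ ^ (-4 : ℤ))) ∧
          (∀ δ L : ℝ, 0 < δ → δ ≤ 1 → 1 ≤ L →
            μ {ω | ∃ lam ∈ GWHF.sparseGrid δ L,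
                GWHF.AlmostDegenerate (GWHF.input F₁ σ F₀ ω) α β lam} ≤
              ENNReal.ofReal
                (C * L ^ 2 * α ^ 2 * β * σ ^ (-4 : ℤ) * δ ^ (-3 / 2 : ℝ))) := by
  refine ⟨156 * 8, by norm_num, fun Ω _ μ _ F₀ F₁ σ hF₀ hF₁ hσ α β hα hβ => ?_⟩
  have hpt := GWHF.measure_almostDegenerate_le hH hF₀ hF₁ hσ hα hβ
  have hz : σ ^ (-4 : ℤ) = 1 / σ ^ 4 := by
    rw [zpow_neg, one_div]
    rfl
  rw [hz]
  have hpos : 0 ≤ α ^ 2 * β / σ ^ 4 := by positivity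
  refine ⟨fun lam => (hpt lam).trans (ENNReal.ofReal_le_ofReal ?_), fun δ L hδ hδ1 hL => ?_⟩
  · have e1 : 8 * α ^ 2 * β / σ ^ 4 = 8 * (α ^ 2 * β / σ ^ 4) := by ring
    have e2 : 156 * 8 * α ^ 2 * β * (1 / σ ^ 4) = 156 * 8 * (α ^ 2 * β / σ ^ 4) := by ring
    rw [e1, e2]
    linarith
  · obtain ⟨s, hs, hcard⟩ := GWHF.exists_finset_sparseGrid_subset hδ hδ1 hL
    calc μ {ω | ∃ lam ∈ GWHF.sparseGrid δ L,
          GWHF.AlmostDegenerate (GWHF.input F₁ σ F₀ ω) α β lam}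
        ≤ μ (⋃ lam ∈ s, {ω | GWHF.AlmostDegenerate (GWHF.input F₁ σ F₀ ω) α β lam}) := by
          refine MeasureTheory.measure_mono ?_
          rintro ω ⟨lam, hlam, hω⟩
          exact Set.mem_iUnion₂.2 ⟨lam, hs hlam, hω⟩
      _ ≤ ∑ lam ∈ s, μ {ω | GWHF.AlmostDegenerate (GWHF.input F₁ σ F₀ ω) α β lam} :=
          MeasureTheory.measure_biUnion_finset_le _ _
      _ ≤ ∑ _lam ∈ s, ENNReal.ofReal (8 * α ^ 2 * β / σ ^ 4) :=
          Finset.sum_le_sum fun lam _ => hpt lam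
      _ = ENNReal.ofReal (s.card * (8 * α ^ 2 * β / σ ^ 4)) := by
          rw [Finset.sum_const, nsmul_eq_mul, ENNReal.ofReal_mul (by positivity),
            ENNReal.ofReal_natCast]
      _ ≤ _ := by
          refine ENNReal.ofReal_le_ofReal ?_
          calc s.card * (8 * α ^ 2 * β / σ ^ 4)
              ≤ 156 * (L ^ 2 * δ ^ (-3 / 2 : ℝ)) * (8 * α ^ 2 * β / σ ^ 4) := by gcongr
            _ = _ := by ring
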